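/- Let $(\xi,\eta)$ be a random vector with almost surely positive, arbitrarily dependent components, and let $(\xi_i,\eta_i)_{i\ge1}$ be independent copies of $(\xi,\eta)$. Let $T=(T_k)_{k\ge1}$ be the perturbed random walk $T_k:=\xi_1+\dots+\xi_{k-1}+\eta_k$. Consider the general branching process generated by $T$: a single ancestor (generation $0$) is born at time $0$; the shifts of the birth times of the children of each individual with respect to its own birth time are given by a copy of $T$, these copies being independent for different individuals. For $j\in\{0,1,2,\dots\}$ and $t\ge0$ let $N_j(t)$ be the number of individuals of the $j$th generation with birth times $\le t$, and $V_j(t):=\mathbb{E}N_j(t)$. **Theorem.** Assume that either (i) $\mathbb{E}\xi^r<\infty$ for some $r\in(1,2]$, or (ii) $\mathbb{P}\{\xi>t\}\sim bt^{-r}$ as $t\to\infty$ for some $r\in(1,2)$ and some $b>0$. Suppose further that $\mathbb{E}(\eta\wedge t)=O(t^{2-r})$ as $t\to\infty$, with the same $r$ as in (i) or (ii). Then $\mathtt{m}:=\mathbb{E}\xi<\infty$, $V_n(t)<\infty$ for all $n\in\{0,1,2,\dots\}$ and $t\ge0$, and for any function $j=j(t)$ with values in $\{0,1,2,\dots\}$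 satisfying $j(t)=o(t^{(r-1)/2})$ as $t\to\infty$, $$V_{j(t)}(t)\sim\frac{t^{j(t)}}{\mathtt{m}^{j(t)}\,(j(t))!},\qquad t\to\infty,$$ that is, the ratio of the two sides tends to $1$. -/

import Mathlib

open MeasureTheory ProbabilityTheory Filter Topology Asymptotics
open scoped ENNReal Nat

/-- The random elements `X i`, `i : ι`, are independent copies of the random element `Y`. -/
structure IsIIDCopies {Ω ι E : Type*} [MeasurableSpace Ω] [MeasurableSpace E]
    (X : ι → Ω → E) (Y : Ω → E) (P : Measure Ω) : Prop where
  indep : iIndepFun X P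
  identDistrib : ∀ i, IdentDistrib (X i) Y P P

/-- The perturbed random walk generated by `(ξ k, η k)`, as a random sequence. Indices start at `0`:
the `k`-th entry is `ξ 0 + ⋯ + ξ (k - 1) + η k`. -/
def perturbedRandomWalk {Ω : Type*} (ξ η : ℕ → Ω → ℝ) (ω : Ω) (k : ℕ) : ℝ :=
  (∑ i ∈ Finset.range k, ξ i ω) + η k ω

/-- Birth times in the general branching process. Individuals are labelled by finite sequences
of natural numbers: `[]` is the ancestor, born at time `0`, and `k :: u` is the child number `k` of
the individual `u`. The shift of its birth time with respect to that of its mother is `τ u ω k`. -/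
def birthTime {Ω : Type*} (τ : List ℕ → Ω → ℕ → ℝ) : List ℕ → Ω → ℝ
  | [], _ => 0
  | k :: u, ω => birthTime τ u ω + τ u ω k

/-- `N_j(t)`: the number of individuals of the `j`-th generation with birth times `≤ t`. -/
noncomputable def generationCount {Ω : Type*} (τ : List ℕ → Ω → ℕ → ℝ) (j : ℕ) (t : ℝ) (ω : Ω) :
    ℕ∞ :=
  Set.encard {u : List ℕ | u.length = j ∧ birthTime τ u ω ≤ t}

/-- `V_j(t) = E N_j(t)`. -/
noncomputable def meanGenerationCount {Ω : Type*} [MeasurableSpace Ω] (P : Measure Ω)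
    (τ : List ℕ → Ω → ℕ → ℝ) (j : ℕ) (t : ℝ) : ℝ≥0∞ :=
  ∫⁻ ω, (generationCount τ j t ω : ℝ≥0∞) ∂P

/-! ### Renewal measures on the half-line -/

/-! Let `m = E ξ`, let `U` be the renewal function of `(S_k)` and `V = V_1`. Since births accumulate
along lines of descent, the mean measure of generation `j` is the `j`-fold convolution of `V`, so
everything reduces to an estimate of `V`: for all `0 ≤ s ≤ T`, `|m V(s) - s| ≤ K(T)` with `K(T) =
O(T^(2-r))`.

For `U`, Wald's identity at the first exit from `(-∞, t]` says that `m U(t) - t` is the mean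
overshoot, `∫ E(ξ - (t - y))⁺ U(dy)`; it is nonnegative. A window of length `d` has `U`-mass at most
`1 / P(ξ > d)`, so the overshoot is at most a constant times `E ξ + E ξ min(ξ, t)`, and either
moment assumption makes the last term `O(t^(2-r))`. The perturbation `η` only decreases the count,
and costs at most `E min(η, t)` after multiplication by `m`.

Convolving a linear bound with itself gives, by induction, `(s - jK)^j ≤ m^j j! V_j(s) ≤ (s + jK)^j`
(the lower bound for `s ≥ jK`). With `s = T = t` the ratio in question lies between `(1 ± jK/t)^j`,
and `j² K / t → 0` exactly because `j = o(t^((r-1)/2))`. -/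

theorem ENNReal.tsum_le_of_telescoping {a g : ℕ → ℝ≥0∞} (h : ∀ k, a (k + 1) + g k ≤ a k) :
    ∑' k, g k ≤ a 0 := by
  have key : ∀ n, a n + ∑ k ∈ Finset.range n, g k ≤ a 0 := by
    intro n
    induction n with
    | zero => simp
    | succ n ih =>
      rw [Finset.sum_range_succ]
      calc a (n + 1) + (∑ k ∈ Finset.range n, g k + g n)
          = (a (n + 1) + g n) + ∑ k ∈ Finset.range n, g k := by ring
        _ ≤ a n + ∑ k ∈ Finset.range n, g k := by gcongr; exact h n
        _ ≤ a 0 := ih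
  rw [ENNReal.tsum_eq_iSup_nat]
  exact iSup_le fun n => le_add_self.trans (key n)

theorem MeasureTheory.Measure.conv_Iic (μ ν : Measure ℝ) [SFinite ν] (s : ℝ) :
    (μ ∗ ν) (Set.Iic s) = ∫⁻ y, ν (Set.Iic (s - y)) ∂μ := by
  rw [← lintegral_indicator_one measurableSet_Iic, Measure.lintegral_conv
    (measurable_one.indicator measurableSet_Iic)]
  refine lintegral_congr fun y => ?_
  rw [← lintegral_indicator_one measurableSet_Iic]
  refine lintegral_congr fun x => ?_
  simp [Set.indicator, le_sub_iff_add_le']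

theorem measure_Iic_of_neg {ν : Measure ℝ} (h : ν (Set.Iio 0) = 0) {s : ℝ} (hs : s < 0) :
    ν (Set.Iic s) = 0 :=
  measure_mono_null (fun _ hx => lt_of_le_of_lt hx hs) h

theorem ae_nonneg_of_measure_Iio {ν : Measure ℝ} (h : ν (Set.Iio 0) = 0) : ∀ᵐ x ∂ν, 0 ≤ x := by
  rw [ae_iff]
  simpa [not_le, Set.Iio] using h

theorem MeasureTheory.Measure.conv_Iio_zero {μ ν : Measure ℝ} [SFinite ν]
    (hμ : μ (Set.Iio 0) = 0) (hν : ν (Set.Iio 0) = 0) : (μ ∗ ν) (Set.Iio 0) = 0 := by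
  rw [← lintegral_indicator_one measurableSet_Iio, Measure.lintegral_conv
    (measurable_one.indicator measurableSet_Iio), ← lintegral_zero]
  refine lintegral_congr_ae ?_
  filter_upwards [ae_nonneg_of_measure_Iio hμ] with y hy
  rw [← lintegral_zero]
  refine lintegral_congr_ae ?_
  filter_upwards [ae_nonneg_of_measure_Iio hν] with x hx
  simp [add_nonneg hy hx]

/-- The sequence of the distributions of the positions of a random walk on the half-line with
step distribution `F`. -/
structure IsWalkLaw (F : Measure ℝ) (μ : ℕ → Measure ℝ) : Prop where
  zero : μ 0 = Measure.dirac 0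
  succ : ∀ k, μ (k + 1) = μ k ∗ F

namespace IsWalkLaw

variable {F : Measure ℝ} {μ : ℕ → Measure ℝ}

theorem isProbabilityMeasure [IsProbabilityMeasure F] (h : IsWalkLaw F μ) (k : ℕ) :
    IsProbabilityMeasure (μ k) := by
  induction k with
  | zero => rw [h.zero]; infer_instance
  | succ k ih => rw [h.succ]; infer_instance

theorem sFinite [SFinite F] (h : IsWalkLaw F μ) (k : ℕ) : SFinite (μ k) := by
  induction k with
  | zero => rw [h.zero]; infer_instance
  | succ k ih => rw [h.succ]; infer_instance

theorem measure_Iio_zero [SFinite F] (h : IsWalkLaw F μ) (hF : F (Set.Iio 0) = 0)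
    (k : ℕ) : μ k (Set.Iio 0) = 0 := by
  induction k with
  | zero => simp [h.zero]
  | succ k ih =>
    rw [h.succ]
    exact Measure.conv_Iio_zero ih hF

/-- The events that the walk leaves `(-∞, s]` by a jump larger than `d` from `(s - d, s]` at time
`k` are disjoint for different `k`. -/
theorem tsum_Ioc_mul_le [IsProbabilityMeasure F] (h : IsWalkLaw F μ) (hF : F (Set.Iio 0) = 0)
    (s d : ℝ) : (∑' k, μ k (Set.Ioc (s - d) s)) * F (Set.Ioi d) ≤ 1 := by
  have := h.isProbabilityMeasure
  rw [← ENNReal.tsum_mul_right]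
  refine (ENNReal.tsum_le_of_telescoping (a := fun k => μ k (Set.Iic s)) fun k => ?_).trans
    prob_le_one
  rw [h.succ, Measure.conv_Iic, ← lintegral_indicator_one (μ := μ k) measurableSet_Iic,
    ← lintegral_indicator_one (μ := μ k) measurableSet_Ioc, ← lintegral_mul_const _
      (measurable_one.indicator measurableSet_Ioc), ← lintegral_add_right _
      ((measurable_one.indicator measurableSet_Ioc).mul_const _)]
  refine lintegral_mono fun y => ?_
  by_cases hy : y ≤ s
  · by_cases hy' : s - d < y
    · simp only [Set.indicator, Set.mem_Ioc, hy', hy, Set.mem_Iic, and_self, if_true,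
        Pi.one_apply, one_mul]
      rw [← measure_union (Set.disjoint_left.2 fun x hx hx' => ?_) measurableSet_Ioi]
      · exact prob_le_one
      · simp only [Set.mem_Iic, Set.mem_Ioi] at hx hx'
        linarith
    · simp [Set.indicator, hy, hy', prob_le_one]
  · simp [Set.indicator, hy, measure_Iic_of_neg hF (sub_neg.2 (not_le.1 hy))]

/-- Cut the half-line below `t` into windows of length `d` counted back from `t`. On the `i`-th one
`G (t - y) ≤ G (i * d)` by monotonicity, and each window has renewal mass at most `1 / F (Set.Ioi
d)`. -/
theorem tsum_setLIntegral_le [IsProbabilityMeasure F] (h : IsWalkLaw F μ)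
    (hF : F (Set.Iio 0) = 0) {d : ℝ} (hd : 0 < d) (hFd : F (Set.Ioi d) ≠ 0)
    {G : ℝ → ℝ≥0∞} (hG : Antitone G) (t : ℝ) :
    ∑' k, ∫⁻ y in Set.Iic t, G (t - y) ∂μ k ≤
      (∑ i ∈ Finset.range (⌊t / d⌋₊ + 1), G (i * d)) / F (Set.Ioi d) := by
  have hpt : ∀ k, ∫⁻ y in Set.Iic t, G (t - y) ∂μ k ≤
      ∑ i ∈ Finset.range (⌊t / d⌋₊ + 1), G (i * d) * μ k (Set.Ioc (t - i * d - d) (t - i * d)) := by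
    intro k
    have : ∀ i : ℕ, G (i * d) * μ k (Set.Ioc (t - i * d - d) (t - i * d)) =
        ∫⁻ y, (Set.Ioc (t - i * d - d) (t - i * d)).indicator (fun _ => G (i * d)) y ∂μ k := by
      intro i
      rw [lintegral_indicator_const measurableSet_Ioc]
    simp_rw [this]
    rw [← lintegral_finsetSum _ fun i _ => measurable_const.indicator measurableSet_Ioc,
      ← lintegral_indicator measurableSet_Iic]
    refine lintegral_mono_ae ?_
    filter_upwards [ae_nonneg_of_measure_Iio (h.measure_Iio_zero hF k)] with y hy
    by_cases hyt : y ≤ t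
    · have h0 : 0 ≤ (t - y) / d := div_nonneg (by linarith) hd.le
      have h1 : (⌊(t - y) / d⌋₊ : ℝ) * d ≤ t - y := (le_div_iff₀ hd).1 (Nat.floor_le h0)
      have h2 : t - y < (⌊(t - y) / d⌋₊ + 1 : ℝ) * d := (div_lt_iff₀ hd).1 (Nat.lt_floor_add_one _)
      rw [Set.indicator_of_mem (Set.mem_Iic.2 hyt)]
      -- Since `y ≥ 0`, the windows up to index `⌊t / d⌋₊` suffice.
      have hmem : ⌊(t - y) / d⌋₊ ∈ Finset.range (⌊t / d⌋₊ + 1) := by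
        rw [Finset.mem_range, Nat.lt_succ_iff]
        exact Nat.floor_le_floor (by gcongr; linarith)
      refine le_trans ?_ (Finset.single_le_sum (fun _ _ => zero_le) hmem)
      rw [Set.indicator_of_mem (Set.mem_Ioc.2 ⟨by linarith, by linarith⟩)]
      exact hG h1
    · simp [hyt]
  calc _ ≤ ∑' k, ∑ i ∈ Finset.range (⌊t / d⌋₊ + 1),
        G (i * d) * μ k (Set.Ioc (t - i * d - d) (t - i * d)) := ENNReal.tsum_le_tsum hpt
    _ = ∑ i ∈ Finset.range (⌊t / d⌋₊ + 1),
        G (i * d) * ∑' k, μ k (Set.Ioc (t - i * d - d) (t - i * d)) := by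
      rw [Summable.tsum_finsetSum fun _ _ => ENNReal.summable]
      simp_rw [ENNReal.tsum_mul_left]
    _ ≤ _ := by
      rw [div_eq_mul_inv _ (F _), Finset.sum_mul]
      gcongr with i
      rw [← one_div (F _), ENNReal.le_div_iff_mul_le (Or.inl hFd) (Or.inl (measure_ne_top _ _))]
      exact h.tsum_Ioc_mul_le hF _ _

theorem tsum_Iic_ne_top [IsProbabilityMeasure F] (h : IsWalkLaw F μ)
    (hF : F (Set.Iio 0) = 0) {d : ℝ} (hd : 0 < d) (hFd : F (Set.Ioi d) ≠ 0) (t : ℝ) :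
    ∑' k, μ k (Set.Iic t) ≠ ∞ := by
  have := h.tsum_setLIntegral_le hF hd hFd (G := fun _ => 1) antitone_const t
  simp only [lintegral_const, Measure.restrict_apply MeasurableSet.univ, Set.univ_inter,
    one_mul] at this
  exact ne_top_of_le_ne_top (ENNReal.div_ne_top (by simp) hFd) this

/-- Wald's identity for the walk stopped at its first exit from `(-∞, t]`, one step at a time. -/
theorem lintegral_min_succ [IsProbabilityMeasure F] (h : IsWalkLaw F μ)
    (hF : F (Set.Iio 0) = 0) {t : ℝ} (ht : 0 ≤ t) (k : ℕ) :
    ∫⁻ y, ENNReal.ofReal (min y t) ∂μ (k + 1) +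
        ∫⁻ y in Set.Iic t, ∫⁻ x, ENNReal.ofReal (x - (t - y)) ∂F ∂μ k =
      ∫⁻ y, ENNReal.ofReal (min y t) ∂μ k +
        (∫⁻ x, ENNReal.ofReal x ∂F) * μ k (Set.Iic t) := by
  have := h.isProbabilityMeasure
  have hm : Measurable fun y => ∫⁻ x, ENNReal.ofReal (x - (t - y)) ∂F :=
    Measurable.lintegral_prod_right' (f := fun p : ℝ × ℝ => ENNReal.ofReal (p.2 - (t - p.1)))
      (by fun_prop)
  rw [h.succ, Measure.lintegral_conv (by fun_prop), ← lintegral_indicator measurableSet_Iic,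
    ← lintegral_indicator_const measurableSet_Iic,
    ← lintegral_add_right _ (hm.indicator measurableSet_Iic),
    ← lintegral_add_left (by fun_prop)]
  refine lintegral_congr_ae ?_
  filter_upwards [ae_nonneg_of_measure_Iio (h.measure_Iio_zero hF k)] with y hy
  by_cases hyt : y ≤ t
  · rw [Set.indicator_of_mem (Set.mem_Iic.2 hyt), Set.indicator_of_mem (Set.mem_Iic.2 hyt),
      ← lintegral_add_left (by fun_prop)]
    -- From `y ≤ t`, a jump `x` gives `min (y + x) t + (x - (t - y))⁺ = y + x`: truncated position
    -- plus overshoot. From `y > t` the truncated position stays at `t`.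
    trans ∫⁻ x, (ENNReal.ofReal (min y t) + ENNReal.ofReal x) ∂F
    · refine lintegral_congr_ae ?_
      filter_upwards [ae_nonneg_of_measure_Iio hF] with x hx
      rw [min_eq_left hyt]
      rcases le_total (y + x) t with hxt | hxt
      · rw [min_eq_left hxt, ENNReal.ofReal_of_nonpos (by linarith : x - (t - y) ≤ 0), add_zero,
          ENNReal.ofReal_add hy hx]
      · rw [min_eq_right hxt, ← ENNReal.ofReal_add ht (by linarith), ← ENNReal.ofReal_add hy hx]
        congr 1
        ring
    · rw [lintegral_add_left measurable_const, lintegral_const, measure_univ, mul_one]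
  · rw [Set.indicator_of_notMem (by simpa using hyt), Set.indicator_of_notMem (by simpa using hyt),
      add_zero, add_zero]
    trans ∫⁻ x, ENNReal.ofReal (min y t) ∂F
    · refine lintegral_congr_ae ?_
      filter_upwards [ae_nonneg_of_measure_Iio hF] with x hx
      rw [min_eq_right (by linarith), min_eq_right (by linarith)]
    · simp

theorem lintegral_min_add_sum [IsProbabilityMeasure F] (h : IsWalkLaw F μ)
    (hF : F (Set.Iio 0) = 0) {t : ℝ} (ht : 0 ≤ t) (n : ℕ) :
    ∫⁻ y, ENNReal.ofReal (min y t) ∂μ n + ∑ k ∈ Finset.range n,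
        ∫⁻ y in Set.Iic t, ∫⁻ x, ENNReal.ofReal (x - (t - y)) ∂F ∂μ k =
      (∫⁻ x, ENNReal.ofReal x ∂F) * ∑ k ∈ Finset.range n, μ k (Set.Iic t) := by
  induction n with
  | zero => simp [h.zero]
  | succ n ih =>
    rw [Finset.sum_range_succ, Finset.sum_range_succ, mul_add, ← ih, add_right_comm _ _ (_ * _),
      ← h.lintegral_min_succ hF ht n]
    ring

theorem mul_tsum_le [IsProbabilityMeasure F] (h : IsWalkLaw F μ)
    (hF : F (Set.Iio 0) = 0) {t : ℝ} (ht : 0 ≤ t) :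
    (∫⁻ x, ENNReal.ofReal x ∂F) * ∑' k, μ k (Set.Iic t) ≤ ENNReal.ofReal t +
      ∑' k, ∫⁻ y in Set.Iic t, ∫⁻ x, ENNReal.ofReal (x - (t - y)) ∂F ∂μ k := by
  have := h.isProbabilityMeasure
  rw [← ENNReal.tsum_mul_left, ENNReal.tsum_eq_iSup_nat]
  refine iSup_le fun n => ?_
  rw [← Finset.mul_sum, ← h.lintegral_min_add_sum hF ht n]
  gcongr
  · calc ∫⁻ y, ENNReal.ofReal (min y t) ∂μ n ≤ ∫⁻ y, ENNReal.ofReal t ∂μ n := by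
          gcongr; exact min_le_right _ _
      _ = ENNReal.ofReal t := by simp
  · exact ENNReal.sum_le_tsum _

/-- Drop the overshoots from Wald's identity. Finiteness of the renewal function forces `μ n
(Set.Iic t) → 0`, so the mean truncated position, at least `t * μ n (Set.Ioi t)`, exhausts `t`. -/
theorem le_mul_tsum [IsProbabilityMeasure F] (h : IsWalkLaw F μ)
    (hF : F (Set.Iio 0) = 0) {t : ℝ} (ht : 0 ≤ t) (hU : ∑' k, μ k (Set.Iic t) ≠ ∞) :
    ENNReal.ofReal t ≤ (∫⁻ x, ENNReal.ofReal x ∂F) * ∑' k, μ k (Set.Iic t) := by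
  have := h.isProbabilityMeasure
  have hlim : Tendsto (fun n => ENNReal.ofReal t * (1 - μ n (Set.Iic t))) atTop
      (𝓝 (ENNReal.ofReal t * (1 - 0))) :=
    ENNReal.Tendsto.const_mul
      (ENNReal.Tendsto.sub tendsto_const_nhds (ENNReal.tendsto_atTop_zero_of_tsum_ne_top hU)
        (Or.inl ENNReal.one_ne_top)) (Or.inr ENNReal.ofReal_ne_top)
  rw [tsub_zero, mul_one] at hlim
  refine le_of_tendsto' hlim fun n => ?_
  have h1 : 1 - μ n (Set.Iic t) = μ n (Set.Ioi t) := by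
    rw [← Set.compl_Iic, prob_compl_eq_one_sub measurableSet_Iic]
  calc ENNReal.ofReal t * (1 - μ n (Set.Iic t))
      = ∫⁻ y in Set.Ioi t, ENNReal.ofReal t ∂μ n := by rw [h1, setLIntegral_const]
    _ ≤ ∫⁻ y in Set.Ioi t, ENNReal.ofReal (min y t) ∂μ n :=
        setLIntegral_mono (by fun_prop) fun y hy => by rw [min_eq_right (le_of_lt hy)]
    _ ≤ ∫⁻ y, ENNReal.ofReal (min y t) ∂μ n := setLIntegral_le_lintegral _ _
    _ ≤ _ := le_self_add
    _ = _ := h.lintegral_min_add_sum hF ht n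
    _ ≤ _ := by gcongr; exact ENNReal.sum_le_tsum _

end IsWalkLaw

/-- Only indices with `i * d < x` contribute: at most `min x t / d + 1` terms, each at most `x`.
This is how the truncated second moment `x * min x t` enters. -/
theorem sum_ofReal_sub_le {x t d : ℝ} (hd : 0 < d) (hx : 0 ≤ x) (ht : 0 ≤ t) :
    ∑ i ∈ Finset.range (⌊t / d⌋₊ + 1), ENNReal.ofReal (x - i * d) ≤
      ENNReal.ofReal (x + x * min x t / d) := by
  have h0 : 0 ≤ min x t / d := div_nonneg (le_min hx ht) hd.le
  calc ∑ i ∈ Finset.range (⌊t / d⌋₊ + 1), ENNReal.ofReal (x - i * d)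
      = ∑ i ∈ Finset.range (⌊t / d⌋₊ + 1) with ((i : ℕ) : ℝ) * d < x, ENNReal.ofReal (x - i * d) := by
        refine (Finset.sum_filter_of_ne fun i _ hi => ?_).symm
        by_contra hlt
        exact hi (ENNReal.ofReal_of_nonpos (by linarith))
    _ ≤ ∑ i ∈ Finset.range (⌊t / d⌋₊ + 1) with ((i : ℕ) : ℝ) * d < x, ENNReal.ofReal x := by
        gcongr with i
        have : (0 : ℝ) ≤ i * d := by positivity
        linarith
    _ ≤ ∑ i ∈ Finset.range (⌊min x t / d⌋₊ + 1), ENNReal.ofReal x := by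
        refine Finset.sum_le_sum_of_subset fun i hi => ?_
        simp only [Finset.mem_filter, Finset.mem_range, Nat.lt_succ_iff] at hi ⊢
        rw [Nat.le_floor_iff h0, le_div_iff₀ hd]
        refine le_min hi.2.le ?_
        rw [← le_div_iff₀ hd]
        exact (Nat.le_floor_iff (div_nonneg ht hd.le)).1 hi.1
    _ ≤ ENNReal.ofReal (x + x * min x t / d) := by
        rw [Finset.sum_const, Finset.card_range, nsmul_eq_mul, ← ENNReal.ofReal_natCast,
          ← ENNReal.ofReal_mul (by positivity)]
        refine ENNReal.ofReal_le_ofReal ?_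
        have := Nat.floor_le h0
        push_cast
        calc ((⌊min x t / d⌋₊ : ℝ) + 1) * x ≤ (min x t / d + 1) * x := by gcongr
          _ = _ := by ring

theorem exists_measure_Ioi_ne_zero {F : Measure ℝ} [IsProbabilityMeasure F]
    (hF : F (Set.Iic 0) = 0) : ∃ d > 0, F (Set.Ioi d) ≠ 0 := by
  by_contra! hcon
  have : F (Set.Ioi (0 : ℝ)) = 0 := by
    refine measure_mono_null (t := ⋃ n : ℕ, Set.Ioi (1 / ((n : ℝ) + 1))) (fun x hx => ?_)
      (measure_iUnion_null fun n => hcon _ (by positivity))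
    exact Set.mem_iUnion.2 (exists_nat_one_div_lt (Set.mem_Ioi.1 hx))
  have huniv : F (Set.Iic 0 ∪ Set.Ioi 0) = 0 := measure_union_null hF this
  rw [Set.Iic_union_Ioi, measure_univ] at huniv
  exact one_ne_zero huniv

/-- Two-sided bounds for the mean number of points `S_k + η_k` in `[0, t]`. -/
theorem IsWalkLaw.exists_perturbed_bounds {F H : Measure ℝ} [IsProbabilityMeasure F]
    [IsProbabilityMeasure H] {μ : ℕ → Measure ℝ} (h : IsWalkLaw F μ)
    (hF : F (Set.Iic 0) = 0) (hH : H (Set.Iio 0) = 0) :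
    ∃ C : ℝ≥0∞, C ≠ ∞ ∧ ∀ t : ℝ, 0 ≤ t →
      (∫⁻ x, ENNReal.ofReal x ∂F) * ∑' k, (μ k ∗ H) (Set.Iic t) ≤ ENNReal.ofReal t +
        C * (∫⁻ x, ENNReal.ofReal x ∂F + ∫⁻ x, ENNReal.ofReal (x * min x t) ∂F) ∧
      ENNReal.ofReal t ≤ (∫⁻ x, ENNReal.ofReal x ∂F) * ∑' k, (μ k ∗ H) (Set.Iic t) +
        ∫⁻ z, ENNReal.ofReal (min z t) ∂H := by
  have hμ := h.isProbabilityMeasure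
  have hF0 : F (Set.Iio 0) = 0 := measure_mono_null Set.Iio_subset_Iic_self hF
  obtain ⟨d, hd, hFd⟩ := exists_measure_Ioi_ne_zero hF
  -- The denominator bounds the renewal mass of a window; `1` and `d⁻¹` are the coefficients in
  -- `sum_ofReal_sub_le`.
  refine ⟨(1 + ENNReal.ofReal d⁻¹) / F (Set.Ioi d), ENNReal.div_ne_top (by simp) hFd,
    fun t ht => ⟨?_, ?_⟩⟩
  · calc (∫⁻ x, ENNReal.ofReal x ∂F) * ∑' k, (μ k ∗ H) (Set.Iic t)
        ≤ (∫⁻ x, ENNReal.ofReal x ∂F) * ∑' k, μ k (Set.Iic t) := by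
          refine mul_le_mul_right (ENNReal.tsum_le_tsum fun k => ?_) _
          rw [Measure.conv_comm, Measure.conv_Iic]
          calc ∫⁻ z, μ k (Set.Iic (t - z)) ∂H ≤ ∫⁻ z, μ k (Set.Iic t) ∂H := by
                refine lintegral_mono_ae ?_
                filter_upwards [ae_nonneg_of_measure_Iio hH] with z hz
                exact measure_mono (Set.Iic_subset_Iic.2 (by linarith))
            _ = μ k (Set.Iic t) := by simp
      _ ≤ ENNReal.ofReal t +
          ∑' k, ∫⁻ y in Set.Iic t, ∫⁻ x, ENNReal.ofReal (x - (t - y)) ∂F ∂μ k :=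
          h.mul_tsum_le hF0 ht
      _ ≤ ENNReal.ofReal t + (∑ i ∈ Finset.range (⌊t / d⌋₊ + 1),
          ∫⁻ x, ENNReal.ofReal (x - i * d) ∂F) / F (Set.Ioi d) := by
          gcongr
          exact h.tsum_setLIntegral_le hF0 hd hFd
            (G := fun z => ∫⁻ x, ENNReal.ofReal (x - z) ∂F)
            (fun z w hzw => lintegral_mono fun x => ENNReal.ofReal_le_ofReal (by linarith)) t
      _ ≤ _ := by
          rw [ENNReal.div_eq_inv_mul, ENNReal.div_eq_inv_mul, mul_assoc]
          gcongr
          rw [← lintegral_finsetSum _ fun i _ => by fun_prop]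
          calc ∫⁻ x, ∑ i ∈ Finset.range (⌊t / d⌋₊ + 1), ENNReal.ofReal (x - i * d) ∂F
              ≤ ∫⁻ x, (ENNReal.ofReal x + ENNReal.ofReal d⁻¹ * ENNReal.ofReal (x * min x t)) ∂F := by
                refine lintegral_mono_ae ?_
                filter_upwards [ae_nonneg_of_measure_Iio hF0] with x hx
                refine (sum_ofReal_sub_le hd hx ht).trans_eq ?_
                rw [ENNReal.ofReal_add hx (div_nonneg (mul_nonneg hx (le_min hx ht)) hd.le),
                  div_eq_inv_mul, ENNReal.ofReal_mul (by positivity)]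
            _ = ∫⁻ x, ENNReal.ofReal x ∂F +
                ENNReal.ofReal d⁻¹ * ∫⁻ x, ENNReal.ofReal (x * min x t) ∂F := by
                rw [lintegral_add_left (by fun_prop), lintegral_const_mul _ (by fun_prop)]
            _ ≤ _ := by
                rw [add_mul, mul_add, mul_add, one_mul, one_mul]
                rw [add_assoc]
                gcongr
                exact le_add_self.trans le_add_self
  · calc ENNReal.ofReal t = ∫⁻ z, ENNReal.ofReal t ∂H := by simp
      -- Split `t = (t - z)⁺ + min z t`; the first part is at most `m U(t - z)` by `le_mul_tsum`,
      -- and averaging over `z` turns `U` into `V`.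
      _ = ∫⁻ z, (ENNReal.ofReal (t - z) + ENNReal.ofReal (min z t)) ∂H := by
          refine lintegral_congr_ae ?_
          filter_upwards [ae_nonneg_of_measure_Iio hH] with z hz
          rcases le_total z t with hzt | hzt
          · rw [min_eq_left hzt, ← ENNReal.ofReal_add (by linarith) hz]
            congr 1
            ring
          · rw [min_eq_right hzt, ENNReal.ofReal_of_nonpos (by linarith : t - z ≤ 0), zero_add]
      _ = ∫⁻ z, ENNReal.ofReal (t - z) ∂H + ∫⁻ z, ENNReal.ofReal (min z t) ∂H :=
          lintegral_add_left (by fun_prop) _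
      _ ≤ _ := by
          gcongr
          calc ∫⁻ z, ENNReal.ofReal (t - z) ∂H
              ≤ ∫⁻ z, (∫⁻ x, ENNReal.ofReal x ∂F) * ∑' k, μ k (Set.Iic (t - z)) ∂H := by
                refine lintegral_mono fun z => ?_
                rcases le_or_gt 0 (t - z) with hz | hz
                · exact h.le_mul_tsum hF0 hz (h.tsum_Iic_ne_top hF0 hd hFd _)
                · rw [ENNReal.ofReal_of_nonpos hz.le]
                  exact zero_le
            _ = _ := by
                have hm : ∀ k, Measurable fun z : ℝ => μ k (Set.Iic (t - z)) := fun k =>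
                  (Antitone.measurable fun a b hab =>
                    measure_mono (Set.Iic_subset_Iic.2 (by linarith)))
                rw [lintegral_const_mul _ (Measurable.tsum hm),
                  lintegral_tsum fun k => (hm k).aemeasurable]
                simp_rw [Measure.conv_comm _ H, Measure.conv_Iic]

/-! ### Iterated convolutions of a measure of nearly linear growth -/

/-- Tonelli: for `y ≥ 0`, `(t - y)⁺` is the length of the set of `s ∈ [0, t)` with `y ≤ s`.
Convolution with a linear function thus becomes integration of the distribution function, which
produces the powers and factorials. -/
theorem lintegral_ofReal_sub {ρ : Measure ℝ} [SFinite ρ] (hρ : ρ (Set.Iio 0) = 0) (t : ℝ) :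
    ∫⁻ y, ENNReal.ofReal (t - y) ∂ρ = ∫⁻ s in Set.Ico 0 t, ρ (Set.Iic s) := by
  have hmeas : MeasurableSet {p : ℝ × ℝ | p.1 ≤ p.2} := measurableSet_le measurable_fst measurable_snd
  calc ∫⁻ y, ENNReal.ofReal (t - y) ∂ρ
      = ∫⁻ y, (∫⁻ s in Set.Ico 0 t, {p : ℝ × ℝ | p.1 ≤ p.2}.indicator 1 (y, s)) ∂ρ := by
        refine lintegral_congr_ae ?_
        filter_upwards [ae_nonneg_of_measure_Iio hρ] with y hy
        have : ∀ s, {p : ℝ × ℝ | p.1 ≤ p.2}.indicator (1 : ℝ × ℝ → ℝ≥0∞) (y, s) =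
            (Set.Ici y).indicator 1 s := fun s => by simp [Set.indicator]
        simp_rw [this]
        rw [lintegral_indicator_one measurableSet_Ici, Measure.restrict_apply measurableSet_Ici,
          show Set.Ici y ∩ Set.Ico 0 t = Set.Ico y t by
            ext s; simp only [Set.mem_inter_iff, Set.mem_Ici, Set.mem_Ico]
            exact ⟨fun h => ⟨h.1, h.2.2⟩, fun h => ⟨h.1, hy.trans h.1, h.2⟩⟩, Real.volume_Ico]
    _ = ∫⁻ s in Set.Ico 0 t, ∫⁻ y, {p : ℝ × ℝ | p.1 ≤ p.2}.indicator 1 (y, s) ∂ρ :=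
        lintegral_lintegral_swap ((measurable_one.indicator hmeas).aemeasurable)
    _ = _ := by
        refine lintegral_congr fun s => ?_
        rw [← lintegral_indicator_one measurableSet_Iic]
        exact lintegral_congr fun y => by simp [Set.indicator]

theorem lintegral_Ico_ofReal_pow {a b c M : ℝ} (hab : a ≤ b) (hac : 0 ≤ a + c) (hM : 0 ≤ M)
    (j : ℕ) :
    ∫⁻ s in Set.Ico a b, ENNReal.ofReal ((s + c) ^ j / M) =
      ENNReal.ofReal (((b + c) ^ (j + 1) - (a + c) ^ (j + 1)) / ((j + 1) * M)) := by
  rw [← ofReal_integral_eq_lintegral_ofReal]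
  · rw [integral_Ico_eq_integral_Ioc, ← intervalIntegral.integral_of_le hab]
    simp only [div_eq_mul_inv]
    rw [intervalIntegral.integral_mul_const,
      intervalIntegral.integral_comp_add_right (fun x : ℝ => x ^ j), integral_pow]
    congr 1
    rw [mul_inv]
    ring
  · exact ((Continuous.integrableOn_Icc (by fun_prop)).mono_set Set.Ico_subset_Icc_self)
  · refine (ae_restrict_iff' measurableSet_Ico).2 (Eventually.of_forall fun s hs => ?_)
    exact div_nonneg (pow_nonneg (by linarith [hs.1]) _) hM

namespace IsWalkLaw

variable {ν : Measure ℝ} {ρ : ℕ → Measure ℝ}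

/-- Convolving with `(s + K) / m` integrates the previous bound and adds `K` times it; both effects
fit into the larger shift `(j + 1) * K`. A single `K` serves throughout, as every argument `t - y`
with `0 ≤ y ≤ t` stays in `[0, T]`. -/
theorem measure_Iic_le [SFinite ν] (h : IsWalkLaw ν ρ) (hν : ν (Set.Iio 0) = 0) {m K T : ℝ}
    (hm : 0 < m) (hK : 0 ≤ K)
    (hV : ∀ s, 0 ≤ s → s ≤ T → ν (Set.Iic s) ≤ ENNReal.ofReal ((s + K) / m)) (j : ℕ) :
    ∀ s, 0 ≤ s → s ≤ T → ρ j (Set.Iic s) ≤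
      ENNReal.ofReal ((s + j * K) ^ j / (m ^ j * (j ! : ℝ))) := by
  induction j with
  | zero =>
    intro s hs _
    simpa [h.zero] using prob_le_one (μ := Measure.dirac (0 : ℝ)) (s := Set.Iic s)
  | succ j ih =>
    intro t ht htT
    have := h.sFinite j
    have hρ := h.measure_Iio_zero hν j
    have hM : (0 : ℝ) < m ^ j * (j ! : ℝ) := by positivity
    calc ρ (j + 1) (Set.Iic t) = ∫⁻ y, ν (Set.Iic (t - y)) ∂ρ j := by rw [h.succ, Measure.conv_Iic]
      _ ≤ ∫⁻ y, (ENNReal.ofReal m⁻¹ * (ENNReal.ofReal (t - y) +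
            (Set.Iic t).indicator (fun _ => ENNReal.ofReal K) y)) ∂ρ j := by
          refine lintegral_mono_ae ?_
          filter_upwards [ae_nonneg_of_measure_Iio hρ] with y hy
          rcases le_or_gt y t with hyt | hyt
          · rw [Set.indicator_of_mem (Set.mem_Iic.2 hyt), ← ENNReal.ofReal_add (by linarith) hK,
              ← ENNReal.ofReal_mul (by positivity), ← div_eq_inv_mul]
            exact hV _ (by linarith) (by linarith)
          · rw [measure_Iic_of_neg hν (by linarith)]
            exact zero_le
      _ = ENNReal.ofReal m⁻¹ * ((∫⁻ s in Set.Ico 0 t, ρ j (Set.Iic s)) +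
            ENNReal.ofReal K * ρ j (Set.Iic t)) := by
          rw [lintegral_const_mul _ (by fun_prop (disch := measurability)),
            lintegral_add_left (by fun_prop), lintegral_ofReal_sub hρ,
            lintegral_indicator_const measurableSet_Iic]
      _ ≤ ENNReal.ofReal m⁻¹ * ((∫⁻ s in Set.Ico 0 t,
            ENNReal.ofReal ((s + j * K) ^ j / (m ^ j * (j ! : ℝ)))) +
            ENNReal.ofReal K * ENNReal.ofReal ((t + j * K) ^ j / (m ^ j * (j ! : ℝ)))) := by
          gcongr _ * (?_ + _ * ?_)
          · exact setLIntegral_mono (by fun_prop) fun s hs => ih s hs.1 (hs.2.le.trans htT)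
          · exact ih t ht htT
      _ ≤ _ := by
          have hjK : 0 ≤ j * K := by positivity
          have hpow : (0 + j * K) ^ (j + 1) ≤ (t + j * K) ^ (j + 1) := by gcongr
          rw [lintegral_Ico_ofReal_pow ht (by simpa using hjK) hM.le,
            ← ENNReal.ofReal_mul hK, ← ENNReal.ofReal_add
              (div_nonneg (by linarith) (by positivity)) (by positivity),
            ← ENNReal.ofReal_mul (by positivity)]
          refine ENNReal.ofReal_le_ofReal ?_
          -- The first two binomial terms of `((t + j * K) + K) ^ (j + 1)`.
          have hb : (t + j * K) ^ (j + 1) + (j + 1 : ℝ) * (t + j * K) ^ j * K ≤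
              (t + (j + 1 : ℕ) * K) ^ (j + 1) := by
            have := pow_add_mul_le_add_pow (a := t + j * K) (b := K) (by positivity) (by positivity) (j + 1)
            rw [Nat.add_sub_cancel] at this
            push_cast at this ⊢
            rw [show t + (j + 1) * K = t + j * K + K by ring]
            linarith
          have h0 : 0 ≤ (0 + j * K) ^ (j + 1) := by positivity
          rw [Nat.factorial_succ, pow_succ m]
          push_cast
          rw [show m⁻¹ * (((t + j * K) ^ (j + 1) - (0 + j * K) ^ (j + 1)) /
              ((j + 1) * (m ^ j * (j ! : ℝ))) + K * ((t + j * K) ^ j / (m ^ j * (j ! : ℝ)))) =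
              ((t + j * K) ^ (j + 1) - (0 + j * K) ^ (j + 1) + (j + 1 : ℝ) * (t + j * K) ^ j * K) /
              (m ^ j * m * ((j + 1) * (j ! : ℝ))) by field_simp]
          gcongr
          push_cast at hb
          linarith

/-- The bound `(t - K - y)⁺ / m` on `ν (Set.Iic (t - y))` integrates the previous estimate up to `t
- K`, which moves the shift from `j * K` to `(j + 1) * K` with equality. The restriction `j * K ≤ s`
keeps the base of the power nonnegative. -/
theorem le_measure_Iic [SFinite ν] (h : IsWalkLaw ν ρ) (hν : ν (Set.Iio 0) = 0) {m K T : ℝ}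
    (hm : 0 < m) (hK : 0 ≤ K)
    (hV : ∀ s, 0 ≤ s → s ≤ T → ENNReal.ofReal ((s - K) / m) ≤ ν (Set.Iic s)) (j : ℕ) :
    ∀ s, j * K ≤ s → s ≤ T →
      ENNReal.ofReal ((s - j * K) ^ j / (m ^ j * (j ! : ℝ))) ≤ ρ j (Set.Iic s) := by
  induction j with
  | zero => intro s hs _; simp at hs; simp [h.zero, hs]
  | succ j ih =>
    intro t ht htT
    have := h.sFinite j
    have hρ := h.measure_Iio_zero hν j
    have hM : (0 : ℝ) < m ^ j * (j ! : ℝ) := by positivity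
    have hjK : 0 ≤ j * K := by positivity
    push_cast at ht
    calc ENNReal.ofReal ((t - (j + 1 : ℕ) * K) ^ (j + 1) / (m ^ (j + 1) * ((j + 1)! : ℝ)))
        = ENNReal.ofReal m⁻¹ * ∫⁻ s in Set.Ico (j * K) (t - K),
            ENNReal.ofReal ((s + -(j * K)) ^ j / (m ^ j * (j ! : ℝ))) := by
          rw [lintegral_Ico_ofReal_pow (by linarith) (by simp) hM.le,
            ← ENNReal.ofReal_mul (by positivity), Nat.factorial_succ, pow_succ m]
          push_cast
          congr 1
          rw [add_neg_cancel, zero_pow (by simp)]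
          field_simp
          ring
      _ ≤ ENNReal.ofReal m⁻¹ * ∫⁻ s in Set.Ico 0 (t - K), ρ j (Set.Iic s) := by
          gcongr _ * ?_
          calc _ ≤ ∫⁻ s in Set.Ico (j * K) (t - K), ρ j (Set.Iic s) :=
                setLIntegral_mono' measurableSet_Ico fun s hs =>
                  by
                    rw [← sub_eq_add_neg]
                    exact ih s hs.1 (by linarith [hs.2])
            _ ≤ _ := lintegral_mono_set (Set.Ico_subset_Ico_left hjK)
      _ = ∫⁻ y, ENNReal.ofReal m⁻¹ * ENNReal.ofReal (t - K - y) ∂ρ j := by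
          rw [lintegral_const_mul _ (by fun_prop), lintegral_ofReal_sub hρ]
      _ ≤ ∫⁻ y, ν (Set.Iic (t - y)) ∂ρ j := by
          refine lintegral_mono_ae ?_
          filter_upwards [ae_nonneg_of_measure_Iio hρ] with y hy
          rw [← ENNReal.ofReal_mul (by positivity), ← div_eq_inv_mul]
          rcases le_or_gt y t with hyt | hyt
          · rw [sub_right_comm]
            exact hV _ (by linarith) (by linarith)
          · rw [ENNReal.ofReal_of_nonpos (div_nonpos_of_nonpos_of_nonneg (by linarith) hm.le)]
            exact zero_le
      _ = ρ (j + 1) (Set.Iic t) := by rw [h.succ, Measure.conv_Iic]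

end IsWalkLaw

/-! ### Truncated moments -/

/-- The integral is `x ^ 2 / 2` for `x ≤ t` and `t * x - t ^ 2 / 2 ≥ t * x / 2` beyond. It puts `x *
min x t` in layer-cake form. -/
theorem mul_min_le_two_mul_integral {x t : ℝ} (hx : 0 ≤ x) (ht : 0 ≤ t) :
    x * min x t ≤ 2 * ∫ u in (0)..x, min u t := by
  have hint : ∀ a b : ℝ, IntervalIntegrable (fun u => min u t) volume a b :=
    fun a b => (by fun_prop : Continuous fun u => min u t).intervalIntegrable a b
  have h1 : ∀ z, 0 ≤ z → z ≤ t → ∫ u in (0)..z, min u t = z ^ 2 / 2 := by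
    intro z hz hzt
    rw [intervalIntegral.integral_congr (g := fun u => u)]
    · rw [integral_id]; ring
    · intro u hu
      rw [Set.uIcc_of_le hz] at hu
      exact min_eq_left (hu.2.trans hzt)
  rcases le_total x t with hxt | hxt
  · rw [min_eq_left hxt, h1 x hx hxt]
    exact le_of_eq (by ring)
  · rw [min_eq_right hxt, ← intervalIntegral.integral_add_adjacent_intervals (hint 0 t) (hint t x),
      h1 t ht le_rfl, intervalIntegral.integral_congr (a := t) (b := x) (g := fun _ => t)]
    · rw [intervalIntegral.integral_const, smul_eq_mul]
      nlinarith
    · intro u hu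
      rw [Set.uIcc_of_le hxt] at hu
      exact min_eq_right hu.1

theorem lintegral_mul_min_le_of_rpow {F : Measure ℝ} (hF : F (Set.Iio 0) = 0) {r : ℝ} (hr1 : 1 < r)
    (hr2 : r ≤ 2) {t : ℝ} (ht : 0 < t) :
    ∫⁻ x, ENNReal.ofReal (x * min x t) ∂F ≤
      (∫⁻ x, ENNReal.ofReal (x ^ r) ∂F) * ENNReal.ofReal (t ^ (2 - r)) := by
  rw [← lintegral_mul_const _ (by fun_prop)]
  refine lintegral_mono_ae ?_
  filter_upwards [ae_nonneg_of_measure_Iio hF] with x hx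
  rw [← ENNReal.ofReal_mul (by positivity)]
  refine ENNReal.ofReal_le_ofReal ?_
  rcases hx.eq_or_lt with rfl | hx
  · simp; positivity
  have hmin : 0 < min x t := lt_min hx ht
  -- Both exponents `r - 1` and `2 - r` are nonnegative, so `min x t` may be replaced by `x` in one
  -- factor and by `t` in the other.
  calc x * min x t = x * (min x t ^ (r - 1) * min x t ^ (2 - r)) := by
        rw [← Real.rpow_add hmin]; norm_num
    _ ≤ x * (x ^ (r - 1) * t ^ (2 - r)) := by
        gcongr
        · exact min_le_left _ _
        · exact min_le_right _ _
    _ = x ^ r * t ^ (2 - r) := by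
        rw [← mul_assoc, ← Real.rpow_one_add' hx.le (by linarith)]
        norm_num

/-- Layer cake bounds the left side by `2 ∫ F(u, ∞) min(u, t) du`, split at `t`. The part `u ^ (1 -
r)` is integrable at `0` because `r < 2`, the part `t * u ^ (-r)` at infinity because `r > 1`. -/
theorem lintegral_mul_min_le_of_tail {F : Measure ℝ} (hF : F (Set.Iio 0) = 0) {r B : ℝ}
    (hr1 : 1 < r) (hr2 : r < 2) (hB : 0 ≤ B)
    (htail : ∀ u, 0 < u → F (Set.Ioi u) ≤ ENNReal.ofReal (B * u ^ (-r))) {t : ℝ} (ht : 0 < t) :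
    ∫⁻ x, ENNReal.ofReal (x * min x t) ∂F ≤
      ENNReal.ofReal (2 * B * (1 / (2 - r) + 1 / (r - 1)) * t ^ (2 - r)) := by
  have hlc := lintegral_comp_eq_lintegral_meas_lt_mul F (f := id) (g := fun u => min u t)
    (ae_nonneg_of_measure_Iio hF) aemeasurable_id
    (fun _ _ => (by fun_prop : Continuous fun u => min u t).intervalIntegrable _ _)
    ((ae_restrict_iff' measurableSet_Ioi).2 (Eventually.of_forall fun u hu => le_min hu.le ht.le))
  simp only [id] at hlc
  calc ∫⁻ x, ENNReal.ofReal (x * min x t) ∂F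
      ≤ ∫⁻ x, ENNReal.ofReal 2 * ENNReal.ofReal (∫ u in (0)..x, min u t) ∂F := by
        refine lintegral_mono_ae ?_
        filter_upwards [ae_nonneg_of_measure_Iio hF] with x hx
        rw [← ENNReal.ofReal_mul zero_le_two]
        exact ENNReal.ofReal_le_ofReal (mul_min_le_two_mul_integral hx ht.le)
    _ = ENNReal.ofReal 2 * ∫⁻ u in Set.Ioi 0, F {a | u < a} * ENNReal.ofReal (min u t) := by
        rw [lintegral_const_mul' _ _ ENNReal.ofReal_ne_top, hlc]
    _ ≤ ENNReal.ofReal 2 * ((∫⁻ u in Set.Ioc 0 t, ENNReal.ofReal (B * u ^ (1 - r))) +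
          ∫⁻ u in Set.Ioi t, ENNReal.ofReal (B * t * u ^ (-r))) := by
        gcongr _ * ?_
        rw [← Set.Ioc_union_Ioi_eq_Ioi ht.le]
        refine (lintegral_union_le _ _ _).trans ?_
        gcongr ?_ + ?_
        · refine setLIntegral_mono' measurableSet_Ioc fun u hu => ?_
          calc _ ≤ ENNReal.ofReal (B * u ^ (-r)) * ENNReal.ofReal u := by
                gcongr
                · exact htail u hu.1
                · exact min_le_left _ _
            _ = _ := by
                rw [← ENNReal.ofReal_mul (mul_nonneg hB (Real.rpow_nonneg hu.1.le _)), mul_assoc]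
                nth_rewrite 2 [← Real.rpow_one u]
                rw [← Real.rpow_add hu.1, neg_add_eq_sub]
        · refine setLIntegral_mono' measurableSet_Ioi fun u hu => ?_
          have hu0 : 0 < u := ht.trans hu
          calc _ ≤ ENNReal.ofReal (B * u ^ (-r)) * ENNReal.ofReal t := by
                gcongr
                · exact htail u hu0
                · exact min_le_right _ _
            _ = _ := by
                rw [← ENNReal.ofReal_mul (mul_nonneg hB (Real.rpow_nonneg hu0.le _))]
                ring_nf
    _ = _ := by
        have e1 : ∫⁻ u in Set.Ioc 0 t, ENNReal.ofReal (B * u ^ (1 - r)) =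
            ENNReal.ofReal (B * (t ^ (2 - r) / (2 - r))) := by
          rw [← ofReal_integral_eq_lintegral_ofReal]
          · rw [← intervalIntegral.integral_of_le ht.le, intervalIntegral.integral_const_mul,
              integral_rpow (Or.inl (by linarith)), Real.zero_rpow (by linarith), sub_zero,
              show 1 - r + 1 = 2 - r by ring]
          · exact (intervalIntegrable_iff_integrableOn_Ioc_of_le ht.le).1
              ((intervalIntegral.intervalIntegrable_rpow' (by linarith)).const_mul B)
          · exact (ae_restrict_iff' measurableSet_Ioc).2 (Eventually.of_forall fun u hu =>
              mul_nonneg hB (Real.rpow_nonneg hu.1.le _))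
        have e2 : ∫⁻ u in Set.Ioi t, ENNReal.ofReal (B * t * u ^ (-r)) =
            ENNReal.ofReal (B * (t ^ (2 - r) / (r - 1))) := by
          rw [← ofReal_integral_eq_lintegral_ofReal]
          · rw [integral_const_mul, integral_Ioi_rpow_of_lt (by linarith) ht]
            congr 1
            rw [show 2 - r = 1 + (-r + 1) by ring, Real.rpow_add ht 1, Real.rpow_one]
            generalize t ^ (-r + 1) = p
            rw [show -r + 1 = -(r - 1) by ring, neg_div_neg_eq]
            ring
          · exact (integrableOn_Ioi_rpow_of_lt (by linarith) ht).const_mul _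
          · exact (ae_restrict_iff' measurableSet_Ioi).2 (Eventually.of_forall fun u hu =>
              mul_nonneg (mul_nonneg hB ht.le) (Real.rpow_nonneg (ht.le.trans (le_of_lt hu)) _))
        have h2 : 0 < 2 - r := by linarith
        have h1 : 0 < r - 1 := by linarith
        rw [e1, e2, ← ENNReal.ofReal_add (by positivity) (by positivity),
          ← ENNReal.ofReal_mul zero_le_two]
        congr 1
        ring

/-! ### Laws of the perturbed random walk and of the birth times -/

section PerturbedWalk

variable {Ω : Type*} [MeasurableSpace Ω] {P : Measure Ω}
  {ξ η : Ω → ℝ} {ξs ηs : ℕ → Ω → ℝ}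

theorem IsIIDCopies.map_eq {ι E : Type*} [MeasurableSpace E] {X : ι → Ω → E} {Y : Ω → E}
    (h : IsIIDCopies X Y P) (i : ι) : P.map (X i) = P.map Y :=
  (h.identDistrib i).map_eq

theorem IsIIDCopies.aemeasurable {ι E : Type*} [MeasurableSpace E] {X : ι → Ω → E} {Y : Ω → E}
    (h : IsIIDCopies X Y P) (i : ι) : AEMeasurable (X i) P :=
  (h.identDistrib i).aemeasurable_fst

theorem IsIIDCopies.isWalkLaw_map_sum [IsProbabilityMeasure P] {X : ℕ → Ω → ℝ} {Y : Ω → ℝ} (h : IsIIDCopies X Y P) :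
    IsWalkLaw (P.map Y) (fun k => P.map (∑ i ∈ Finset.range k, X i)) where
  zero := by simp [Pi.zero_def]
  succ k := by
    have hm := h.aemeasurable
    rw [Finset.sum_range_succ, ← h.map_eq k]
    exact (h.indep.indepFun_finsetSum_of_notMem₀ hm
      Finset.notMem_range_self).map_add_eq_map_conv_map₀
        (Finset.aemeasurable_sum _ fun i _ => hm i) (hm k)

theorem IsIIDCopies.comp {ι E E' : Type*} [MeasurableSpace E] [MeasurableSpace E']
    {X : ι → Ω → E} {Y : Ω → E} (h : IsIIDCopies X Y P) {g : E → E'} (hg : Measurable g) :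
    IsIIDCopies (fun i ω => g (X i ω)) (fun ω => g (Y ω)) P where
  indep := h.indep.comp (fun _ => g) fun _ => hg
  identDistrib i := (h.identDistrib i).comp hg

/-- The dependence between `ξ` and `η` is harmless: entry `k` involves `η k` and only those `ξ i`
with `i < k`, which come from other independent pairs. -/
theorem map_perturbedRandomWalk [IsProbabilityMeasure P]
    (h : IsIIDCopies (fun (k : ℕ) (ω : Ω) => (ξs k ω, ηs k ω)) (fun ω => (ξ ω, η ω)) P) (k : ℕ) :
    P.map (fun ω => perturbedRandomWalk ξs ηs ω k) =
      P.map (∑ i ∈ Finset.range k, ξs i) ∗ P.map η := by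
  have hξ := h.comp measurable_fst
  have hη := h.comp measurable_snd
  have hind : iIndepFun (fun i ω => if i = k then ηs i ω else ξs i ω) P := by
    have hg : ∀ i, Measurable fun p : ℝ × ℝ => if i = k then p.2 else p.1 := fun i => by
      by_cases hi : i = k
      · simpa [hi] using measurable_snd
      · simpa [hi] using measurable_fst
    exact h.indep.comp (fun i p => if i = k then p.2 else p.1) hg
  have hm : ∀ i, AEMeasurable (fun ω => if i = k then ηs i ω else ξs i ω) P := by
    intro i
    by_cases hi : i = k
    · simpa [hi] using hη.aemeasurable k
    · simpa [hi] using hξ.aemeasurable i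
  have hsum : ∑ i ∈ Finset.range k, (fun ω => if i = k then ηs i ω else ξs i ω) =
      ∑ i ∈ Finset.range k, ξs i :=
    Finset.sum_congr rfl fun i hi => by simp [(Finset.mem_range.1 hi).ne]
  have := hind.indepFun_finsetSum_of_notMem₀ hm (Finset.notMem_range_self (n := k))
  simp only [hsum, if_true] at this
  rw [← hη.map_eq k, ← this.map_add_eq_map_conv_map₀
    (Finset.aemeasurable_sum _ fun i _ => hξ.aemeasurable i) (hη.aemeasurable k)]
  congr 1
  ext ω
  simp [perturbedRandomWalk]

end PerturbedWalk

/-- The proper suffixes of `u` are its ancestors; the displacements of the children of `u` itself do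
not enter its birth time. -/
theorem birthTime_congr {Ω Ω' : Type*} {τ : List ℕ → Ω → ℕ → ℝ} {τ' : List ℕ → Ω' → ℕ → ℝ}
    {ω : Ω} {ω' : Ω'} (u : List ℕ) (h : ∀ v, v <:+ u → v ≠ u → τ v ω = τ' v ω') :
    birthTime τ u ω = birthTime τ' u ω' := by
  induction u with
  | nil => rfl
  | cons k u ih =>
    simp only [birthTime]
    rw [h u (List.suffix_cons k u) (List.ne_cons_self), ih fun v hv hvu =>
      h v (hv.trans (List.suffix_cons k u)) fun hvk => ?_]
    subst hvk
    simpa using hv.length_le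

theorem aemeasurable_birthTime {Ω : Type*} [MeasurableSpace Ω] {P : Measure Ω}
    {τ : List ℕ → Ω → ℕ → ℝ} (h : ∀ u, AEMeasurable (τ u) P) (u : List ℕ) :
    AEMeasurable (birthTime τ u) P := by
  induction u with
  | nil => exact aemeasurable_const
  | cons k u ih => exact ih.add ((measurable_pi_apply k).comp_aemeasurable (h u))

theorem measurable_birthTime {Ω : Type*} [MeasurableSpace Ω]
    {τ : List ℕ → Ω → ℕ → ℝ} (h : ∀ u, Measurable (τ u)) (u : List ℕ) :
    Measurable (birthTime τ u) := by
  induction u with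
  | nil => exact measurable_const
  | cons k u ih => exact ih.add ((measurable_pi_apply k).comp (h u))

theorem indepFun_birthTime {Ω : Type*} [MeasurableSpace Ω] {P : Measure Ω} [IsProbabilityMeasure P]
    {τ : List ℕ → Ω → ℕ → ℝ} (hind : iIndepFun τ P) (hm : ∀ u, AEMeasurable (τ u) P)
    (u : List ℕ) : IndepFun (birthTime τ u) (τ u) P := by
  have hdisj : Disjoint (u.tails.toFinset.erase u) {u} := by simp
  -- Extension by `0` of displacements known only for the ancestors of `u`; by `birthTime_congr` the
  -- default is never read.
  let e : List ℕ → (↥(u.tails.toFinset.erase u) → ℕ → ℝ) → ℕ → ℝ :=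
    fun v x => if h : v ∈ u.tails.toFinset.erase u then x ⟨v, h⟩ else 0
  have he : ∀ v, Measurable (e v) := by
    intro v
    by_cases h : v ∈ u.tails.toFinset.erase u
    · simp only [e, h, dif_pos]
      exact measurable_pi_apply _
    · simp only [e, h, dif_neg, not_false_iff]
      exact measurable_const
  have := (hind.indepFun_finset₀ _ _ hdisj hm).comp (measurable_birthTime he u)
    (measurable_pi_apply (⟨u, Finset.mem_singleton_self u⟩ : ({u} : Finset (List ℕ))))
  have heq : birthTime τ u = birthTime e u ∘ fun ω (v : ↥(u.tails.toFinset.erase u)) => τ v ω := by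
    ext ω
    refine birthTime_congr u fun v hv hvu => ?_
    simp [e, hv, hvu]
  rw [heq]
  exact this

/-- The intensity measure of the birth times in the `j`-th generation. -/
noncomputable def generationIntensity {Ω : Type*} [MeasurableSpace Ω] (P : Measure Ω)
    (τ : List ℕ → Ω → ℕ → ℝ) (j : ℕ) : Measure ℝ :=
  Measure.sum fun u : {u : List ℕ // u.length = j} => P.map (birthTime τ u)

theorem meanGenerationCount_eq {Ω : Type*} [MeasurableSpace Ω] {P : Measure Ω}
    {τ : List ℕ → Ω → ℕ → ℝ} (hm : ∀ u, AEMeasurable (τ u) P) (j : ℕ) (t : ℝ) :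
    meanGenerationCount P τ j t = generationIntensity P τ j (Set.Iic t) := by
  have hB := aemeasurable_birthTime hm
  have hcount : ∀ ω, (generationCount τ j t ω : ℝ≥0∞) =
      ∑' u : {u : List ℕ // u.length = j}, (Set.Iic t).indicator 1 (birthTime τ u ω) := by
    intro ω
    have himg : {u : List ℕ | u.length = j ∧ birthTime τ u ω ≤ t} = Subtype.val ''
        {u : {u : List ℕ // u.length = j} | birthTime τ u ω ≤ t} := by
      ext u
      simp [and_comm]
    let _ : MeasurableSpace {u : List ℕ // u.length = j} := ⊤
    rw [generationCount, himg, Subtype.val_injective.injOn.encard_image,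
      ← Measure.count_apply MeasurableSpace.measurableSet_top,
      ← lintegral_indicator_one MeasurableSpace.measurableSet_top, lintegral_count]
    rfl
  simp_rw [meanGenerationCount, hcount]
  have hBt : ∀ u : {u : List ℕ // u.length = j},
      AEMeasurable (fun ω => (Set.Iic t).indicator (1 : ℝ → ℝ≥0∞) (birthTime τ u ω)) P :=
    fun u => (measurable_one.indicator measurableSet_Iic).comp_aemeasurable (hB u)
  rw [lintegral_tsum hBt, generationIntensity, Measure.sum_apply _ measurableSet_Iic]
  refine tsum_congr fun u => ?_
  rw [← lintegral_map' (measurable_one.indicator measurableSet_Iic).aemeasurable (hB u),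
    lintegral_indicator_one measurableSet_Iic]

/-- A list of length `j + 1` is made of its tail and its head. -/
noncomputable def listConsEquiv (α : Type*) (j : ℕ) :
    {u : List α // u.length = j} × α ≃ {u : List α // u.length = j + 1} :=
  Equiv.ofBijective (fun p => ⟨p.2 :: p.1, by simp [p.1.2]⟩) <| by
    refine ⟨fun p q hpq => ?_, fun ⟨u, hu⟩ => ?_⟩
    · simp only [Subtype.mk.injEq, List.cons.injEq] at hpq
      exact Prod.ext (Subtype.ext hpq.2) hpq.1
    · obtain ⟨a, v, rfl⟩ := List.exists_cons_of_length_eq_add_one hu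
      exact ⟨(⟨v, by simpa using hu⟩, a), rfl⟩

theorem MeasureTheory.Measure.sum_conv_sum {ι κ : Type*} [Countable κ]
    (μ : ι → Measure ℝ) (ν : κ → Measure ℝ) [∀ k, SFinite (ν k)] :
    Measure.sum μ ∗ Measure.sum ν = Measure.sum fun p : ι × κ => μ p.1 ∗ ν p.2 := by
  ext A hA
  have hind : Measurable (A.indicator (1 : ℝ → ℝ≥0∞)) := measurable_one.indicator hA
  rw [Measure.sum_apply _ hA, ENNReal.tsum_prod', ← lintegral_indicator_one hA,
    Measure.lintegral_conv hind, lintegral_sum_measure]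
  refine tsum_congr fun i => ?_
  simp_rw [lintegral_sum_measure]
  rw [lintegral_tsum fun k => (Measurable.lintegral_prod_right'
    (f := fun p : ℝ × ℝ => A.indicator (1 : ℝ → ℝ≥0∞) (p.1 + p.2))
    (hind.comp measurable_add)).aemeasurable]
  refine tsum_congr fun k => ?_
  rw [← lintegral_indicator_one hA, Measure.lintegral_conv hind]

/-- Each child is born at its mother's birth time plus an independent entry of the walk, so
intensities convolve. The step measure here is in general infinite, which is why `IsWalkLaw` does
not ask for probability measures. -/
theorem isWalkLaw_generationIntensity {Ω : Type*} [MeasurableSpace Ω] {P : Measure Ω}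
    [IsProbabilityMeasure P] {τ : List ℕ → Ω → ℕ → ℝ} {T : Ω → ℕ → ℝ} (hτ : IsIIDCopies τ T P) :
    IsWalkLaw (Measure.sum fun k => P.map fun ω => T ω k) (generationIntensity P τ) where
  zero := by
    ext A hA
    rw [generationIntensity, Measure.sum_apply _ hA, tsum_eq_single
      (⟨[], rfl⟩ : {u : List ℕ // u.length = 0})
      fun u hu => (hu (Subtype.ext (List.length_eq_zero_iff.1 u.2))).elim]
    have : birthTime τ [] = fun _ => 0 := by
      ext ω
      rfl
    simp [this]
  succ j := by
    have hm := hτ.aemeasurable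
    have hT : ∀ k, AEMeasurable (fun ω => T ω k) P := fun k =>
      (measurable_pi_apply k).comp_aemeasurable (hτ.identDistrib []).aemeasurable_snd
    have hT' : ∀ k, IsProbabilityMeasure (P.map fun ω => T ω k) := fun k =>
      Measure.isProbabilityMeasure_map (hT k)
    rw [generationIntensity, generationIntensity, Measure.sum_conv_sum,
      ← Measure.sum_comp_equiv (listConsEquiv ℕ j)]
    congr 1
    ext1 ⟨u, k⟩
    have hk : P.map (fun ω => τ u ω k) = P.map fun ω => T ω k :=
      ((hτ.identDistrib u).comp (measurable_pi_apply k)).map_eq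
    have hind : IndepFun (birthTime τ u) (fun ω => τ u ω k) P :=
      (indepFun_birthTime hτ.indep hm u).comp measurable_id (measurable_pi_apply k)
    rw [← hk]
    exact hind.map_add_eq_map_conv_map₀ (aemeasurable_birthTime hm u)
      ((measurable_pi_apply k).comp_aemeasurable (hm u))

/-! ### Asymptotics -/

theorem lintegral_ofReal_ne_top_of_mul_min {F : Measure ℝ} [IsProbabilityMeasure F]
    (h : ∫⁻ x, ENNReal.ofReal (x * min x 1) ∂F ≠ ∞) :
    ∫⁻ x, ENNReal.ofReal x ∂F ≠ ∞ := by
  refine ne_top_of_le_ne_top (b := 1 + ∫⁻ x, ENNReal.ofReal (x * min x 1) ∂F)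
    (ENNReal.add_ne_top.2 ⟨ENNReal.one_ne_top, h⟩) ?_
  calc ∫⁻ x, ENNReal.ofReal x ∂F ≤ ∫⁻ x, (1 + ENNReal.ofReal (x * min x 1)) ∂F := by
        refine lintegral_mono fun x => ?_
        rcases le_total x 1 with hx | hx
        · exact (ENNReal.ofReal_le_one.2 hx).trans le_self_add
        · rw [min_eq_right hx, mul_one]
          exact le_add_self
    _ = _ := by rw [lintegral_add_left measurable_const]; simp

theorem lintegral_ofReal_ne_zero {F : Measure ℝ} [IsProbabilityMeasure F]
    (hF : F (Set.Iic 0) = 0) : ∫⁻ x, ENNReal.ofReal x ∂F ≠ 0 := by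
  intro h0
  rw [lintegral_eq_zero_iff (by fun_prop)] at h0
  have h1 : ∀ᵐ x ∂F, x ∉ Set.Iic (0 : ℝ) := measure_eq_zero_iff_ae_notMem.1 hF
  obtain ⟨x, hx0, hx1⟩ := (h0.and h1).exists
  exact hx1 (ENNReal.ofReal_eq_zero.1 hx0)

theorem IsWalkLaw.exists_perturbed_linear_bounds {F H : Measure ℝ} [IsProbabilityMeasure F]
    [IsProbabilityMeasure H] {μ : ℕ → Measure ℝ} (h : IsWalkLaw F μ)
    (hF : F (Set.Iic 0) = 0) (hH : H (Set.Iio 0) = 0) {r D : ℝ} (hr : r ≤ 2)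
    (hA : ∀ t, 0 < t → ∫⁻ x, ENNReal.ofReal (x * min x t) ∂F ≤ ENNReal.ofReal (D * t ^ (2 - r)))
    (hE : (fun t => (∫⁻ z, ENNReal.ofReal (min z t) ∂H).toReal) =O[atTop]
      fun t : ℝ => t ^ (2 - r)) :
    ∃ K : ℝ → ℝ, (∀ t, 0 ≤ K t) ∧ K =O[atTop] (fun t : ℝ => t ^ (2 - r)) ∧
      ∀ T, 0 < T → ∀ s, 0 ≤ s → s ≤ T →
        Measure.sum (fun k => μ k ∗ H) (Set.Iic s) ≤
          ENNReal.ofReal ((s + K T) / (∫⁻ x, ENNReal.ofReal x ∂F).toReal) ∧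
        ENNReal.ofReal ((s - K T) / (∫⁻ x, ENNReal.ofReal x ∂F).toReal) ≤
          Measure.sum (fun k => μ k ∗ H) (Set.Iic s) := by
  have hAtop : ∀ t, 0 < t → ∫⁻ x, ENNReal.ofReal (x * min x t) ∂F ≠ ∞ := fun t ht =>
    ne_top_of_le_ne_top ENNReal.ofReal_ne_top (hA t ht)
  have hmtop := lintegral_ofReal_ne_top_of_mul_min (hAtop 1 one_pos)
  have hm0 := lintegral_ofReal_ne_zero hF
  have hEtop : ∀ t, ∫⁻ z, ENNReal.ofReal (min z t) ∂H ≠ ∞ := fun t =>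
    ne_top_of_le_ne_top (b := ∫⁻ z, ENNReal.ofReal t ∂H) (by simp)
      (lintegral_mono fun z => ENNReal.ofReal_le_ofReal (min_le_right _ _))
  obtain ⟨C, hC, hbd⟩ := h.exists_perturbed_bounds hF hH
  set M := ∫⁻ x, ENNReal.ofReal x ∂F with hM
  have hMpos : 0 < M.toReal := ENNReal.toReal_pos hm0 hmtop
  have hMof : ENNReal.ofReal M.toReal = M := ENNReal.ofReal_toReal hmtop
  have htop : ∀ t, 0 < t → C * (M + ∫⁻ x, ENNReal.ofReal (x * min x t) ∂F) ≠ ∞ := fun t ht =>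
    ENNReal.mul_ne_top hC (ENNReal.add_ne_top.2 ⟨hmtop, hAtop t ht⟩)
  -- Both error terms are nondecreasing in the truncation level, so their values at `T` serve for
  -- every `s ≤ T`.
  refine ⟨fun t => (C * (M + ∫⁻ x, ENNReal.ofReal (x * min x t) ∂F)).toReal +
    (∫⁻ z, ENNReal.ofReal (min z t) ∂H).toReal, fun t => by positivity, ?_, ?_⟩
  · refine IsBigO.add (IsBigO.of_bound (C.toReal * (M.toReal + |D|)) ?_) hE
    filter_upwards [eventually_ge_atTop 1] with t ht
    have ht0 : 0 < t := by linarith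
    have hpow : 1 ≤ t ^ (2 - r) := Real.one_le_rpow ht (by linarith)
    have hAle : (∫⁻ x, ENNReal.ofReal (x * min x t) ∂F).toReal ≤ |D| * t ^ (2 - r) :=
      ENNReal.toReal_le_of_le_ofReal (by positivity) ((hA t ht0).trans
        (ENNReal.ofReal_le_ofReal (by gcongr; exact le_abs_self D)))
    rw [Real.norm_of_nonneg ENNReal.toReal_nonneg, Real.norm_of_nonneg (by positivity),
      ENNReal.toReal_mul, ENNReal.toReal_add hmtop (hAtop t ht0), mul_assoc]
    gcongr
    nlinarith
  · intro T hT s hs hsT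
    obtain ⟨h1, h2⟩ := hbd s hs
    rw [Measure.sum_apply _ measurableSet_Iic]
    set V := ∑' k, (μ k ∗ H) (Set.Iic s)
    set a := (C * (M + ∫⁻ x, ENNReal.ofReal (x * min x T) ∂F)).toReal with ha
    set e := (∫⁻ z, ENNReal.ofReal (min z T) ∂H).toReal with he
    have ha0 : 0 ≤ a := ENNReal.toReal_nonneg
    have he0 : 0 ≤ e := ENNReal.toReal_nonneg
    constructor
    · rw [ENNReal.ofReal_div_of_pos hMpos, hMof,
        ENNReal.le_div_iff_mul_le (Or.inl hm0) (Or.inl hmtop), mul_comm]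
      calc M * V ≤ ENNReal.ofReal s + C * (M + ∫⁻ x, ENNReal.ofReal (x * min x s) ∂F) := h1
        _ ≤ ENNReal.ofReal s + C * (M + ∫⁻ x, ENNReal.ofReal (x * min x T) ∂F) := by
            gcongr _ + _ * (_ + ?_)
            refine lintegral_mono_ae ?_
            filter_upwards [ae_nonneg_of_measure_Iio
              (measure_mono_null Set.Iio_subset_Iic_self hF)] with x hx
            gcongr
        _ = ENNReal.ofReal (s + a) := by
            rw [ENNReal.ofReal_add hs ha0, ha, ENNReal.ofReal_toReal (htop T hT)]
        _ ≤ _ := ENNReal.ofReal_le_ofReal (by linarith)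
    · rw [ENNReal.ofReal_div_of_pos hMpos, hMof]
      refine ENNReal.div_le_of_le_mul' ?_
      calc ENNReal.ofReal (s - (a + e)) ≤ ENNReal.ofReal (s - e) :=
            ENNReal.ofReal_le_ofReal (by linarith)
        _ = ENNReal.ofReal s - ENNReal.ofReal e := ENNReal.ofReal_sub _ he0
        _ ≤ M * V := by
            rw [tsub_le_iff_right, he, ENNReal.ofReal_toReal (hEtop T)]
            refine h2.trans ?_
            gcongr

/-- Bernoulli's inequality below and `1 + x ≤ exp x` above squeeze `R` between `1 - j² K / t` and
`exp (j² K / t)`. -/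
theorem tendsto_one_of_pow_bounds {R K : ℝ → ℝ} {j : ℝ → ℕ} (hK : ∀ t, 0 ≤ K t)
    (hjK : Tendsto (fun t => (j t : ℝ) ^ 2 * K t / t) atTop (𝓝 0))
    (hup : ∀ᶠ t in atTop, R t ≤ (1 + j t * K t / t) ^ j t)
    (hlow : ∀ᶠ t in atTop, j t * K t ≤ t → (1 - j t * K t / t) ^ j t ≤ R t) :
    Tendsto R atTop (𝓝 1) := by
  have h1 : Tendsto (fun t => 1 - (j t : ℝ) ^ 2 * K t / t) atTop (𝓝 1) := by
    simpa using hjK.const_sub 1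
  have h2 : Tendsto (fun t => Real.exp ((j t : ℝ) ^ 2 * K t / t)) atTop (𝓝 1) := by
    rw [← Real.exp_zero]
    exact (Real.continuous_exp.tendsto 0).comp hjK
  refine tendsto_of_tendsto_of_tendsto_of_le_of_le' h1 h2 ?_ ?_
  · filter_upwards [hlow, hjK.eventually (ge_mem_nhds zero_lt_one), eventually_gt_atTop 0]
      with t ht h1 ht0
    -- For natural numbers `j ≤ j²`, so eventually `j K ≤ t` and the lower bound applies.
    have hj : (j t : ℝ) ≤ (j t : ℝ) ^ 2 := by exact_mod_cast Nat.le_self_pow two_ne_zero _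
    have hle : j t * K t / t ≤ 1 :=
      le_trans (by have := hK t; gcongr) h1
    refine le_trans ?_ (ht (by simpa using (div_le_iff₀ ht0).1 hle))
    have := one_add_mul_le_pow (a := -(j t * K t / t)) (by linarith) (j t)
    rw [← sub_eq_add_neg] at this
    refine le_trans (le_of_eq ?_) this
    ring
  · filter_upwards [hup, eventually_gt_atTop 0] with t ht ht0
    have h0 : 0 ≤ j t * K t / t := by have := hK t; positivity
    calc R t ≤ (1 + j t * K t / t) ^ j t := ht
      _ ≤ Real.exp (j t * K t / t) ^ j t := by
          gcongr
          linarith [Real.add_one_le_exp (j t * K t / t)]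
      _ = Real.exp ((j t : ℝ) ^ 2 * K t / t) := by
          rw [← Real.exp_nat_mul]
          congr 1
          ring

theorem IsWalkLaw.tendsto_measure_Iic_div {ν : Measure ℝ} [SFinite ν] {ρ : ℕ → Measure ℝ}
    (h : IsWalkLaw ν ρ) (hν : ν (Set.Iio 0) = 0) {m r : ℝ} (hm : 0 < m) {K : ℝ → ℝ}
    (hK : ∀ t, 0 ≤ K t) (hKO : K =O[atTop] fun t : ℝ => t ^ (2 - r))
    (hV : ∀ T, 0 < T → ∀ s, 0 ≤ s → s ≤ T → ν (Set.Iic s) ≤ ENNReal.ofReal ((s + K T) / m) ∧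
      ENNReal.ofReal ((s - K T) / m) ≤ ν (Set.Iic s)) {j : ℝ → ℕ}
    (hj : (fun t : ℝ => (j t : ℝ)) =o[atTop] (fun t : ℝ => t ^ ((r - 1) / 2))) :
    Tendsto (fun t : ℝ => (ρ (j t) (Set.Iic t)).toReal / (t ^ j t / (m ^ j t * ((j t)! : ℝ))))
      atTop (𝓝 1) := by
  refine tendsto_one_of_pow_bounds (j := j) hK ?_ ?_ ?_
  -- The exponents cancel: `(r - 1) + (2 - r) - 1 = 0`.
  · have h1 : (fun t : ℝ => (j t : ℝ) ^ 2 * K t / t) =o[atTop] fun t : ℝ =>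
        (t ^ ((r - 1) / 2)) ^ 2 * t ^ (2 - r) * t⁻¹ := by
      simp only [div_eq_mul_inv]
      exact ((hj.pow two_pos).mul_isBigO hKO).mul_isBigO (isBigO_refl _ _)
    refine (isLittleO_one_iff ℝ).1 (h1.congr' EventuallyEq.rfl ?_)
    filter_upwards [eventually_gt_atTop 0] with t ht
    rw [← Real.rpow_natCast, ← Real.rpow_mul ht.le, ← Real.rpow_neg_one t, ← Real.rpow_add ht,
      ← Real.rpow_add ht]
    norm_num
  · filter_upwards [eventually_gt_atTop 0] with t ht
    have hKt := hK t
    have := ENNReal.toReal_le_of_le_ofReal (by positivity)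
      (h.measure_Iic_le hν hm hKt (fun s hs hsT => (hV t ht s hs hsT).1) (j t) t ht.le le_rfl)
    rw [div_le_iff₀ (by positivity)]
    refine this.trans (le_of_eq ?_)
    rw [mul_div_assoc', ← mul_pow]
    congr 2
    field_simp
  · filter_upwards [eventually_gt_atTop 0] with t ht hjt
    have hKt := hK t
    have hfin := ne_top_of_le_ne_top ENNReal.ofReal_ne_top
      (h.measure_Iic_le hν hm hKt (fun s hs hsT => (hV t ht s hs hsT).1) (j t) t ht.le le_rfl)
    have := (ENNReal.ofReal_le_iff_le_toReal hfin).1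
      (h.le_measure_Iic hν hm hKt (fun s hs hsT => (hV t ht s hs hsT).2) (j t) t hjt le_rfl)
    rw [le_div_iff₀ (by positivity)]
    refine le_trans (le_of_eq ?_) this
    rw [mul_div_assoc', ← mul_pow]
    congr 2
    field_simp

theorem exists_tail_le_of_isEquivalent {F : Measure ℝ} [IsProbabilityMeasure F] {r b : ℝ}
    (hr : 0 < r) (hb : 0 < b)
    (h : (fun t : ℝ => F.real (Set.Ioi t)) ~[atTop] (fun t : ℝ => b * t ^ (-r))) :
    ∃ B, 0 ≤ B ∧ ∀ u, 0 < u → F (Set.Ioi u) ≤ ENNReal.ofReal (B * u ^ (-r)) := by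
  obtain ⟨c, hc, hO⟩ := h.isBigO.exists_pos
  obtain ⟨t₀, ht₀⟩ := eventually_atTop.1 (hO.bound.and (eventually_gt_atTop 0))
  have ht₀pos : 0 < t₀ := (ht₀ t₀ le_rfl).2
  -- Beyond `t₀` the asymptotics give `c * b`; below it a probability is at most `1 = u ^ r * u ^
  -- (-r) ≤ t₀ ^ r * u ^ (-r)`.
  refine ⟨max (c * b) (t₀ ^ r), by positivity, fun u hu => ?_⟩
  rw [← ofReal_measureReal]
  refine ENNReal.ofReal_le_ofReal ?_
  rcases le_total t₀ u with htu | htu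
  · have := (ht₀ u htu).1
    rw [Real.norm_of_nonneg measureReal_nonneg, Real.norm_of_nonneg (by positivity),
      ← mul_assoc] at this
    refine this.trans ?_
    gcongr
    exact le_max_left _ _
  · calc F.real (Set.Ioi u) ≤ 1 := measureReal_le_one
      _ = u ^ r * u ^ (-r) := by rw [← Real.rpow_add hu]; simp
      _ ≤ max (c * b) (t₀ ^ r) * u ^ (-r) := by
          gcongr
          exact le_trans (by gcongr) (le_max_right _ _)

theorem theorem2p2 {Ω : Type*} [MeasurableSpace Ω] (P : Measure Ω) [IsProbabilityMeasure P]
    -- the generic vector `(ξ, η)`, and the sequence of its independent copies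
    (ξ η : Ω → ℝ) (hξpos : ∀ᵐ ω ∂P, 0 < ξ ω) (hηpos : ∀ᵐ ω ∂P, 0 < η ω)
    (ξs ηs : ℕ → Ω → ℝ)
    (hcopies : IsIIDCopies (fun (k : ℕ) (ω : Ω) => (ξs k ω, ηs k ω)) (fun ω => (ξ ω, η ω)) P)
    -- the birth time shifts of the children of the individuals: independent copies of the walk
    (τ : List ℕ → Ω → ℕ → ℝ) (hτ : IsIIDCopies τ (perturbedRandomWalk ξs ηs) P)
    (r : ℝ)
    (hξ : (1 < r ∧ r ≤ 2 ∧ Integrable (fun ω => ξ ω ^ r) P) ∨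
      (1 < r ∧ r < 2 ∧ ∃ b : ℝ, 0 < b ∧
        (fun t : ℝ => P.real {ω | t < ξ ω}) ~[atTop] (fun t : ℝ => b * t ^ (-r))))
    (hη : (fun t : ℝ => ∫ ω, min (η ω) t ∂P) =O[atTop] (fun t : ℝ => t ^ (2 - r)))
    (j : ℝ → ℕ)
    (hj : (fun t : ℝ => (j t : ℝ)) =o[atTop] (fun t : ℝ => t ^ ((r - 1) / 2))) :
    Integrable ξ P ∧
    (∀ (n : ℕ) (t : ℝ), meanGenerationCount P τ n t < ∞) ∧
    Tendsto
      (fun t : ℝ => (meanGenerationCount P τ (j t) t).toReal /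
        (t ^ (j t) / ((∫ ω, ξ ω ∂P) ^ (j t) * ((j t)! : ℝ))))
      atTop (𝓝 1) := by
  have hpair := (hcopies.identDistrib 0).aemeasurable_snd
  have hξm : AEMeasurable ξ P := measurable_fst.comp_aemeasurable hpair
  have hηm : AEMeasurable η P := measurable_snd.comp_aemeasurable hpair
  have hFprob : IsProbabilityMeasure (P.map ξ) := Measure.isProbabilityMeasure_map hξm
  have hHprob : IsProbabilityMeasure (P.map η) := Measure.isProbabilityMeasure_map hηm
  have hF : P.map ξ (Set.Iic 0) = 0 := by
    rw [Measure.map_apply_of_aemeasurable hξm measurableSet_Iic]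
    exact measure_eq_zero_iff_ae_notMem.2 (hξpos.mono fun ω h => not_le.2 h)
  have hF0 : P.map ξ (Set.Iio 0) = 0 := measure_mono_null Set.Iio_subset_Iic_self hF
  have hH : P.map η (Set.Iio 0) = 0 := by
    rw [Measure.map_apply_of_aemeasurable hηm measurableSet_Iio]
    exact measure_eq_zero_iff_ae_notMem.2 (hηpos.mono fun ω h => not_lt.2 h.le)
  have hr2 : r ≤ 2 := by
    rcases hξ with h | h
    · exact h.2.1
    · exact h.2.1.le
  -- The two moment assumptions merge here; at `t = 1` this bound also yields the finite mean.
  obtain ⟨D, hA⟩ : ∃ D, ∀ t, 0 < t →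
      ∫⁻ x, ENNReal.ofReal (x * min x t) ∂P.map ξ ≤ ENNReal.ofReal (D * t ^ (2 - r)) := by
    rcases hξ with ⟨h1, h2, hint⟩ | ⟨h1, h2, b, hb, hequiv⟩
    · have hfin : ∫⁻ x, ENNReal.ofReal (x ^ r) ∂P.map ξ ≠ ∞ := by
        rw [lintegral_map' (by fun_prop) hξm]
        exact hint.lintegral_lt_top.ne
      refine ⟨(∫⁻ x, ENNReal.ofReal (x ^ r) ∂P.map ξ).toReal, fun t ht => ?_⟩
      rw [ENNReal.ofReal_mul ENNReal.toReal_nonneg, ENNReal.ofReal_toReal hfin]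
      exact lintegral_mul_min_le_of_rpow hF0 h1 h2 ht
    · obtain ⟨B, hB, htail⟩ := exists_tail_le_of_isEquivalent (F := P.map ξ) (r := r)
        (by linarith) hb <| hequiv.congr_left <| Eventually.of_forall fun t => by
          simp only [measureReal_def]
          rw [Measure.map_apply_of_aemeasurable hξm measurableSet_Ioi]
          rfl
      exact ⟨_, fun t ht => lintegral_mul_min_le_of_tail hF0 h1 h2 hB htail ht⟩
  have hE : (fun t => (∫⁻ z, ENNReal.ofReal (min z t) ∂P.map η).toReal) =O[atTop]
      fun t : ℝ => t ^ (2 - r) := by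
    refine hη.congr' ?_ EventuallyEq.rfl
    filter_upwards [eventually_ge_atTop 0] with t ht
    rw [lintegral_map' (by fun_prop) hηm, integral_eq_lintegral_of_nonneg_ae
      (hηpos.mono fun ω h => le_min h.le ht) (hηm.min aemeasurable_const).aestronglyMeasurable]
  have hmtop : ∫⁻ x, ENNReal.ofReal x ∂P.map ξ ≠ ∞ := lintegral_ofReal_ne_top_of_mul_min
    (ne_top_of_le_ne_top ENNReal.ofReal_ne_top (hA 1 one_pos))
  have hξnn : 0 ≤ᵐ[P] ξ := hξpos.mono fun ω h => h.le
  have hmξ : ∫⁻ x, ENNReal.ofReal x ∂P.map ξ = ∫⁻ ω, ENNReal.ofReal (ξ ω) ∂P :=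
    lintegral_map' (by fun_prop) hξm
  have hmean : (∫⁻ x, ENNReal.ofReal x ∂P.map ξ).toReal = ∫ ω, ξ ω ∂P := by
    rw [hmξ, integral_eq_lintegral_of_nonneg_ae hξnn hξm.aestronglyMeasurable]
  have hmpos : 0 < ∫ ω, ξ ω ∂P := by
    rw [← hmean]
    exact ENNReal.toReal_pos (lintegral_ofReal_ne_zero hF) hmtop
  have hwalk : IsWalkLaw (P.map ξ) fun k => P.map (∑ i ∈ Finset.range k, ξs i) :=
    (hcopies.comp measurable_fst).isWalkLaw_map_sum
  have hμ := hwalk.isProbabilityMeasure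
  obtain ⟨K, hK, hKO, hV⟩ := hwalk.exists_perturbed_linear_bounds hF hH hr2 hA hE
  rw [hmean] at hV
  have hgen := isWalkLaw_generationIntensity hτ
  simp_rw [map_perturbedRandomWalk hcopies] at hgen
  have hν : Measure.sum (fun k => P.map (∑ i ∈ Finset.range k, ξs i) ∗ P.map η)
      (Set.Iio 0) = 0 := by
    rw [Measure.sum_apply_eq_zero]
    exact fun k => Measure.conv_Iio_zero (hwalk.measure_Iio_zero hF0 k) hH
  simp_rw [meanGenerationCount_eq hτ.aemeasurable]
  refine ⟨(lintegral_ofReal_ne_top_iff_integrable hξm.aestronglyMeasurable hξnn).1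
    (hmξ ▸ hmtop), fun n t => ?_, hgen.tendsto_measure_Iic_div hν hmpos hK hKO hV hj⟩
  -- A positive horizon above `t`, since the growth bounds need one and `t` may be negative or zero.
  have ht : 0 < |t| + 1 := by positivity
  calc _ ≤ generationIntensity P τ n (Set.Iic (|t| + 1)) :=
        measure_mono (Set.Iic_subset_Iic.2 (by linarith [le_abs_self t]))
    _ ≤ _ := hgen.measure_Iic_le hν hmpos (hK _) (fun s hs hsT => (hV _ ht s hs hsT).1) n _
        ht.le le_rfl
    _ < ∞ := ENNReal.ofReal_lt_top
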